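/- Let $d\ge 0$ be an integer and let $\mu^-,\mu^+$ be compactly supported Borel probability measures on $\mathbb{R}^d$. For $\varepsilon>0$, an optimal entropic plan $\gamma_\varepsilon$ between $\mu^-$ and $\mu^+$ (for the quadratic cost) is a coupling of $\mu^-$ and $\mu^+$ that minimizes $$\gamma\mapsto \frac12\int_{\mathbb{R}^d\times\mathbb{R}^d}|x-y|^2\,d\gamma(x,y)+\varepsilon\,\mathrm{Ent}(\gamma\,|\,\mu^-\otimes\mu^+)$$ among all couplings $\gamma$ of $\mu^-$ and $\mu^+$, where $\mathrm{Ent}$ denotes the relative entropy (Kullback–Leibler divergence). Suppose that the Brenier map from $\mu^-$ to $\mu^+$ is globally $M$-Lipschitz, that is: there is a convex differentiable function $f:\mathbb{R}^d\to\mathbb{R}$ whose gradient $T=\nabla f:\mathbb{R}^d\to\mathbb{R}^d$ is $M$-Lipschitz and satisfies $T_\#\mu^-=\mu^+$. Then there is a constant $C$, independent of $\varepsilon$, such that for every $\varepsilon\in(0,1)$ and every optimal entropic plan $\gamma_\varepsilon$, the function $(x,y)\mapsto|y-T(x)|^2$ is $\gamma_\varepsilon$-integrable and $$\int_{\mathbb{R}^d\times\mathbb{R}^d}|y-T(x)|^2\,d\gamma_\varepsilon(x,y)\le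 M\big(d\,\varepsilon\log(1/\varepsilon)+C\varepsilon\big).$$ Moreover, let $T_\varepsilon(x)=\int y\,d\gamma_\varepsilon^x(y)$ be the barycentric projection of $\gamma_\varepsilon$, where $(\gamma_\varepsilon^x)_x$ is the disintegration of $\gamma_\varepsilon$ with respect to its first marginal $\mu^-$ (so that $T_\varepsilon(x)$ is the conditional expectation of $Y$ given $X=x$ when $(X,Y)$ has law $\gamma_\varepsilon$). Then $T_\varepsilon-T\in L^2(\mu^-)$ and $$\|T_\varepsilon-T\|_{L^2(\mu^-)}^2\le M\big(d\,\varepsilon\log(1/\varepsilon)+C\varepsilon\big).$$ -/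

import Mathlib

open MeasureTheory InformationTheory
open scoped ENNReal NNReal

/-- A coupling of `μ` and `ν`: a measure on the product with marginals `μ` and `ν`. -/
structure IsCoupling {X Y : Type*} [MeasurableSpace X] [MeasurableSpace Y]
    (μ : Measure X) (ν : Measure Y) (γ : Measure (X × Y)) : Prop where
  fst_eq : γ.fst = μ
  snd_eq : γ.snd = ν

/-- The quadratic entropic transport functional
`½ ∫ ‖x - y‖² dγ + ε Ent(γ | μ ⊗ ν)`, with values in `[0, ∞]`. For probability measures, `klDiv`
is the relative entropy (equal to `∞` when `γ` is not absolutely continuous or when the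
entropy integral is infinite). -/
noncomputable def entropicFunctional {d : ℕ} (μ ν : Measure (EuclideanSpace ℝ (Fin d))) (ε : ℝ)
    (γ : Measure (EuclideanSpace ℝ (Fin d) × EuclideanSpace ℝ (Fin d))) : ℝ≥0∞ :=
  (∫⁻ p, ENNReal.ofReal (‖p.1 - p.2‖ ^ 2 / 2) ∂γ) + ENNReal.ofReal ε * klDiv γ (μ.prod ν)

/-- `γ` is an optimal entropic plan between `μ` and `ν` with parameter `ε` for the quadratic
cost: a coupling that minimises the entropic functional among all couplings. -/
structure IsOptimalEntropicPlan {d : ℕ} (μ ν : Measure (EuclideanSpace ℝ (Fin d))) (ε : ℝ)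
    (γ : Measure (EuclideanSpace ℝ (Fin d) × EuclideanSpace ℝ (Fin d))) : Prop where
  coupling : IsCoupling μ ν γ
  minimal : ∀ γ' : Measure (EuclideanSpace ℝ (Fin d) × EuclideanSpace ℝ (Fin d)),
    IsCoupling μ ν γ' → entropicFunctional μ ν ε γ ≤ entropicFunctional μ ν ε γ'

/-- `T = ∇f` is an (everywhere defined) Brenier map from `μ` to `ν`: `f` is a convex function on
`ℝᵈ`, `T` is its gradient, and `T` pushes `μ` forward to `ν`. -/
structure IsBrenierMap {d : ℕ} (μ ν : Measure (EuclideanSpace ℝ (Fin d)))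
    (f : EuclideanSpace ℝ (Fin d) → ℝ)
    (T : EuclideanSpace ℝ (Fin d) → EuclideanSpace ℝ (Fin d)) : Prop where
  convex : ConvexOn ℝ Set.univ f
  gradient : ∀ x, HasGradientAt f (T x) x
  map_eq : μ.map T = ν

/-- The barycentric projection of `γ`: the conditional expectation of `Y` given `X = x` when
`(X, Y)` has law `γ`, computed with the disintegration of `γ` with respect to its first marginal. -/
noncomputable def barycentricProjection {d : ℕ}
    (γ : Measure (EuclideanSpace ℝ (Fin d) × EuclideanSpace ℝ (Fin d))) [IsFiniteMeasure γ]
    (x : EuclideanSpace ℝ (Fin d)) : EuclideanSpace ℝ (Fin d) :=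
  ∫ y, y ∂(γ.condKernel x)

/-! Let `K` be the support of `μ` and let `E x y = f x + f* y - ⟪x, y⟫` be the duality gap, with
`f*` computed over `K`. At `y = T x'` with `x' ∈ K` it is the Bregman divergence of `f`, so the
Lipschitz gradient gives `‖T x - T x'‖² / (2M) ≤ E x (T x') ≤ M/2 ‖x - x'‖²`. The lower bound
reduces the theorem to bounding `∫ E` under the optimal plan.

The quadratic cost differs from `E` by functions of one variable, so minimality yields `∫ E ∂γ ≤ ∫ E
∂γ' + ε Ent(γ')` for any coupling `γ'` (`IsOptimalEntropicPlan.integral_dualityGap_le`). The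
competitor couples `x` with `T x'`, where `x'` is redrawn from `μ` in the grid cell of `x`. With
mesh `√ε` its gap is at most `M d ε / 2`, and its entropy is at most the log of the number of cells,
hence `d/2 log(1/ε) + O(1)`. Jensen then handles the barycentric projection. -/

/-! ### Convex functions with Lipschitz gradient. -/

section Convex

variable {E : Type*} [NormedAddCommGroup E] [InnerProductSpace ℝ E] [CompleteSpace E]
  {f : E → ℝ} {T : E → E}

lemma HasGradientAt.hasDerivAt_comp_line {g x v : E} {t : ℝ} (h : HasGradientAt f g (x + t • v)) :
    HasDerivAt (fun s : ℝ => f (x + s • v)) (inner ℝ g v) t := by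
  have h1 : HasDerivAt (fun s : ℝ => x + s • v) v t := by
    simpa using ((hasDerivAt_id t).smul_const v).const_add x
  simpa [Function.comp_def] using! h.hasFDerivAt.comp_hasDerivAt t h1

lemma ConvexOn.add_inner_le_of_hasGradientAt (hf : ConvexOn ℝ Set.univ f) {g x : E}
    (h : HasGradientAt f g x) (y : E) : f x + inner ℝ g (y - x) ≤ f y := by
  have hc : ConvexOn ℝ Set.univ (fun s : ℝ => f (x + s • (y - x))) := by
    have := hf.comp_affineMap (AffineMap.lineMap x y : ℝ →ᵃ[ℝ] E)
    refine (this.congr ?_)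
    intro s _
    simp [AffineMap.lineMap_apply, add_comm]
  have hd : HasDerivAt (fun s : ℝ => f (x + s • (y - x))) (inner ℝ g (y - x)) 0 :=
    HasGradientAt.hasDerivAt_comp_line (by simpa using h)
  have := hc.le_slope_of_hasDerivAt (Set.mem_univ 0) (Set.mem_univ 1) one_pos hd
  simp [slope_def_field] at this
  linarith

lemma LipschitzWith.le_add_inner_add_of_hasGradientAt {M : ℝ≥0} (hT : ∀ x, HasGradientAt f (T x) x)
    (hM : LipschitzWith M T) (x y : E) :
    f y ≤ f x + inner ℝ (T x) (y - x) + M / 2 * ‖y - x‖ ^ 2 := by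
  set v := y - x with hv
  have hd : ∀ t : ℝ, HasDerivAt (fun s : ℝ => f (x + s • v) - s * inner ℝ (T x) v
      - M / 2 * ‖v‖ ^ 2 * s ^ 2)
      (inner ℝ (T (x + t • v)) v - inner ℝ (T x) v - M * ‖v‖ ^ 2 * t) t := by
    intro t
    have h1 := HasGradientAt.hasDerivAt_comp_line (hT (x + t • v))
    have h2 := (hasDerivAt_id t).mul_const (inner ℝ (T x) v)
    have h3 := ((hasDerivAt_id t).pow 2).const_mul (M / 2 * ‖v‖ ^ 2)
    convert! (h1.sub h2).sub h3 using 1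
    simp; ring
  have ha : AntitoneOn (fun s : ℝ => f (x + s • v) - s * inner ℝ (T x) v
      - M / 2 * ‖v‖ ^ 2 * s ^ 2) (Set.Icc 0 1) := by
    refine antitoneOn_of_deriv_nonpos (convex_Icc 0 1)
      (fun t _ => (hd t).continuousAt.continuousWithinAt)
      (fun t _ => (hd t).differentiableAt.differentiableWithinAt) ?_
    intro t ht
    rw [interior_Icc] at ht
    rw [(hd t).deriv, ← inner_sub_left]
    have h1 := real_inner_le_norm (T (x + t • v) - T x) v
    have h2 : ‖T (x + t • v) - T x‖ ≤ M * (t * ‖v‖) := by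
      refine (hM.norm_sub_le _ _).trans_eq ?_
      rw [add_sub_cancel_left, norm_smul, Real.norm_of_nonneg ht.1.le]
    nlinarith [norm_nonneg v]
  have := ha (Set.left_mem_Icc.2 zero_le_one) (Set.right_mem_Icc.2 zero_le_one) zero_le_one
  simp [hv] at this
  linarith

/-- Compare, at one gradient step `z` from `x`, the quadratic upper bound based at `x` with the
tangent lower bound based at `y`. -/
lemma ConvexOn.norm_sub_sq_le_of_lipschitzWith_gradient {M : ℝ≥0} (hf : ConvexOn ℝ Set.univ f)
    (hT : ∀ x, HasGradientAt f (T x) x) (hM : LipschitzWith M T) (x y : E) :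
    ‖T x - T y‖ ^ 2 ≤ 2 * M * (f x - f y - inner ℝ (T y) (x - y)) := by
  rcases eq_or_ne M 0 with rfl | h0
  · have := hM.norm_sub_le x y
    simp at this
    simp [this]
  have hMpos : (0 : ℝ) < M := by positivity
  set w := T x - T y
  -- The step length `1/M` optimises the comparison; it is why `M = 0` is treated apart.
  set z := x - (M : ℝ)⁻¹ • w with hz
  have h1 := hM.le_add_inner_add_of_hasGradientAt hT x z
  have h2 := hf.add_inner_le_of_hasGradientAt (hT y) z
  have e1 : z - x = -((M : ℝ)⁻¹ • w) := by rw [hz]; abel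
  have e2 : z - y = (x - y) - (M : ℝ)⁻¹ • w := by rw [hz]; abel
  rw [e1, inner_neg_right, inner_smul_right, norm_neg, norm_smul, norm_inv,
    Real.norm_of_nonneg hMpos.le] at h1
  rw [e2, inner_sub_right, inner_smul_right] at h2
  have e3 : inner ℝ (T x) w - inner ℝ (T y) w = ‖w‖ ^ 2 := by
    rw [← inner_sub_left, real_inner_self_eq_norm_sq]
  have e4 : (M : ℝ) / 2 * ((M : ℝ)⁻¹ * ‖w‖) ^ 2 = (M : ℝ)⁻¹ * ‖w‖ ^ 2 / 2 := by
    field_simp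
  have h3 : (M : ℝ)⁻¹ * ‖w‖ ^ 2 / 2 ≤ f x - f y - inner ℝ (T y) (x - y) := by
    rw [e4] at h1
    rw [← e3] at h1 ⊢
    nlinarith
  calc ‖w‖ ^ 2 = 2 * M * ((M : ℝ)⁻¹ * ‖w‖ ^ 2 / 2) := by field_simp
    _ ≤ _ := by gcongr

end Convex

/-! ### Conjugate over a compact set. -/

section Conjugate

variable {E : Type*} [NormedAddCommGroup E] [InnerProductSpace ℝ E]

/-- The convex conjugate of the function that equals `f` on `K` and `∞` off `K`. -/
noncomputable def conjugateOn (K : Set E) (f : E → ℝ) (y : E) : ℝ :=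
  sSup ((fun x => inner ℝ x y - f x) '' K)

lemma continuous_conjugateOn {K : Set E} (hK : IsCompact K) {f : E → ℝ} (hf : Continuous f) :
    Continuous (conjugateOn K f) :=
  hK.continuous_sSup (f := fun y x => inner ℝ x y - f x) (by fun_prop)

lemma ConvexOn.conjugateOn_gradient [CompleteSpace E] {K : Set E} {f : E → ℝ}
    (hf : ConvexOn ℝ Set.univ f) {x g : E} (hx : x ∈ K) (h : HasGradientAt f g x) :
    conjugateOn K f g = inner ℝ x g - f x := by
  refine IsGreatest.csSup_eq ⟨⟨x, hx, rfl⟩, ?_⟩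
  rintro _ ⟨y, -, rfl⟩
  have := hf.add_inner_le_of_hasGradientAt h y
  rw [inner_sub_right, real_inner_comm y, real_inner_comm x] at this
  linarith

end Conjugate

/-! ### Cubic grids and cell counting. -/

section Grid

/-- The index of the cell of the cubic grid of mesh `δ` that contains `x`. -/
noncomputable def gridIndex {d : ℕ} (δ : ℝ) (x : EuclideanSpace ℝ (Fin d)) : Fin d → ℤ :=
  fun i => ⌊x i / δ⌋

lemma measurable_gridIndex {d : ℕ} (δ : ℝ) : Measurable (gridIndex (d := d) δ) := by
  unfold gridIndex
  fun_prop

lemma norm_sub_sq_le_of_gridIndex_eq {d : ℕ} {δ : ℝ} (hδ : 0 < δ)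
    {x y : EuclideanSpace ℝ (Fin d)} (h : gridIndex δ x = gridIndex δ y) :
    ‖x - y‖ ^ 2 ≤ d * δ ^ 2 := by
  rw [EuclideanSpace.norm_sq_eq]
  have : ∀ i, ‖(x - y) i‖ ^ 2 ≤ δ ^ 2 := by
    intro i
    have h1 := Int.abs_sub_lt_one_of_floor_eq_floor (congrFun h i)
    rw [← sub_div, abs_div, abs_of_pos hδ, div_lt_one hδ] at h1
    have h2 : ‖(x - y) i‖ ≤ δ := by simpa using h1.le
    gcongr
  simpa using Finset.sum_le_sum fun i (_ : i ∈ Finset.univ) => this i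

lemma exists_finset_gridIndex_mem {d : ℕ} {K : Set (EuclideanSpace ℝ (Fin d))} (hK : IsCompact K) :
    ∃ A : ℝ, 0 < A ∧ ∀ δ : ℝ, 0 < δ → δ ≤ 1 →
      ∃ s : Finset (Fin d → ℤ), (∀ x ∈ K, gridIndex δ x ∈ s) ∧ (s.card : ℝ) ≤ (A / δ) ^ d := by
  obtain ⟨R, hR, hKR⟩ := hK.isBounded.exists_pos_norm_le
  -- Each coordinate index lies in `[-n, n]` with `n = ⌈R/δ⌉`, and `(2n + 1) δ < 2R + 3δ ≤ 2R + 3`.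
  refine ⟨2 * R + 3, by positivity, fun δ hδ hδ1 => ?_⟩
  set n := ⌈R / δ⌉₊
  refine ⟨Fintype.piFinset fun _ => Finset.Icc (-(n : ℤ)) n, fun x hx => ?_, ?_⟩
  · rw [Fintype.mem_piFinset]
    intro i
    have h1 : |x i / δ| ≤ R / δ := by
      rw [abs_div, abs_of_pos hδ]
      gcongr
      exact (PiLp.norm_apply_le x i).trans (hKR x hx)
    have h2 := abs_le.1 (h1.trans (Nat.le_ceil _))
    rw [Finset.mem_Icc]
    constructor
    · exact Int.le_floor.2 (by simpa using h2.1)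
    · exact Int.floor_le_iff.2 (by push_cast; linarith [h2.2])
  · rw [Fintype.card_piFinset]
    simp only [Int.card_Icc, Finset.prod_const, Finset.card_univ, Fintype.card_fin, Nat.cast_pow]
    gcongr
    have h1 : ((n : ℤ) + 1 - -(n : ℤ)).toNat = 2 * n + 1 := by omega
    rw [h1, le_div_iff₀ hδ]
    have h2 : (n : ℝ) < R / δ + 1 := Nat.ceil_lt_add_one (by positivity)
    have h3 : (n : ℝ) * δ < R + δ := by
      calc (n : ℝ) * δ < (R / δ + 1) * δ := by gcongr
        _ = R + δ := by field_simp
    push_cast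
    linarith

end Grid

/-! ### Entropy bound from the mean density. -/

section Entropy

variable {α : Type*} [MeasurableSpace α]

/-- Jensen for the logarithm, through its tangent line at `N`. The bound `1 ≤ h` gives `0 ≤ log h ≤
h`, hence integrability. -/
lemma klDiv_withDensity_le_log {π : Measure α} [IsProbabilityMeasure π] {h : α → ℝ≥0∞}
    (hm : Measurable h) [IsProbabilityMeasure (π.withDensity h)]
    (h1 : ∀ᵐ x ∂π.withDensity h, 1 ≤ h x) {N : ℝ} (hN : 0 < N)
    (hle : ∫⁻ x, h x ∂π.withDensity h ≤ ENNReal.ofReal N) :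
    klDiv (π.withDensity h) π ≤ ENNReal.ofReal (Real.log N) := by
  set σ := π.withDensity h with hσ
  have hac : σ ≪ π := withDensity_absolutelyContinuous π h
  have hfin : ∀ᵐ x ∂σ, h x < ∞ := ae_lt_top hm (hle.trans_lt ENNReal.ofReal_lt_top).ne
  have hllr : llr σ π =ᵐ[σ] fun x => Real.log (h x).toReal := by
    filter_upwards [hac.ae_le (Measure.rnDeriv_withDensity π hm)] with x hx
    rw [llr, hx]
  have hint : Integrable (fun x => (h x).toReal) σ :=
    integrable_toReal_of_lintegral_ne_top hm.aemeasurable (hle.trans_lt ENNReal.ofReal_lt_top).ne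
  have h1' : ∀ᵐ x ∂σ, 1 ≤ (h x).toReal := by
    filter_upwards [h1, hfin] with x hx hx'
    simpa using ENNReal.toReal_mono hx'.ne hx
  have hlog : Integrable (fun x => Real.log (h x).toReal) σ := by
    refine hint.mono' hm.ennreal_toReal.log.aestronglyMeasurable ?_
    filter_upwards [h1'] with x hx
    rw [Real.norm_of_nonneg (Real.log_nonneg hx)]
    exact Real.log_le_self (zero_le_one.trans hx)
  have hval : ∫ x, (h x).toReal ∂σ ≤ N := by
    rw [integral_toReal hm.aemeasurable hfin]
    exact ENNReal.toReal_le_of_le_ofReal hN.le hle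
  rw [klDiv_of_ac_of_integrable hac ((integrable_congr hllr).2 hlog), integral_congr_ae hllr]
  apply ENNReal.ofReal_le_ofReal
  simp only [probReal_univ, add_sub_cancel_right]
  calc ∫ x, Real.log (h x).toReal ∂σ ≤ ∫ x, ((h x).toReal / N + (Real.log N - 1)) ∂σ := by
        refine integral_mono_ae hlog ((hint.div_const N).add (integrable_const _)) ?_
        filter_upwards [h1'] with x hx
        have hpos : 0 < (h x).toReal := zero_lt_one.trans_le hx
        have := Real.log_le_sub_one_of_pos (div_pos hpos hN)
        rw [Real.log_div hpos.ne' hN.ne'] at this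
        linarith
    _ = (∫ x, (h x).toReal ∂σ) / N + (Real.log N - 1) := by
        rw [integral_add (hint.div_const N) (integrable_const _), integral_div]
        simp
    _ ≤ Real.log N := by
        have : (∫ x, (h x).toReal ∂σ) / N ≤ 1 := (div_le_one hN).2 hval
        linarith

end Entropy

/-! ### Block approximation of the diagonal coupling. -/

section Block

variable {α ι : Type*} [MeasurableSpace α] {μ : Measure α} {q : α → ι}

/-- The density with respect to `μ ⊗ μ` of the block approximation of the diagonal coupling of `μ`:
the normalised restriction of `μ ⊗ μ` to the pairs of points in the same cell of `q`. -/
noncomputable def blockDensity (μ : Measure α) (q : α → ι) (p : α × α) : ℝ≥0∞ :=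
  {p : α × α | q p.1 = q p.2}.indicator (fun p => (μ (q ⁻¹' {q p.1}))⁻¹) p

/-- The block approximation of the diagonal coupling of `μ` along the cells of `q`. -/
noncomputable def blockCoupling (μ : Measure α) (q : α → ι) : Measure (α × α) :=
  (μ.prod μ).withDensity (blockDensity μ q)

lemma blockDensity_swap (p : α × α) : blockDensity μ q p.swap = blockDensity μ q p := by
  by_cases h : q p.1 = q p.2
  · simp [blockDensity, Set.indicator, h]
  · simp [blockDensity, Set.indicator, h, Ne.symm h]

lemma blockDensity_right_eq (x : α) :
    (fun y => blockDensity μ q (x, y))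
      = (q ⁻¹' {q x}).indicator fun _ => (μ (q ⁻¹' {q x}))⁻¹ := by
  ext y
  by_cases h : q x = q y
  · simp [blockDensity, Set.indicator, h]
  · simp [blockDensity, Set.indicator, h, Ne.symm h]

lemma ae_measure_cell_ne_zero [Countable ι] : ∀ᵐ x ∂μ, μ (q ⁻¹' {q x}) ≠ 0 := by
  have : {x | ¬ μ (q ⁻¹' {q x}) ≠ 0} = ⋃ i ∈ {i | μ (q ⁻¹' {i}) = 0}, q ⁻¹' {i} := by
    ext x; simp
  rw [ae_iff, this]
  exact (measure_biUnion_null_iff (Set.to_countable _)).2 fun i hi => hi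

variable [MeasurableSpace ι] [Countable ι] [MeasurableSingletonClass ι]

lemma measurableSet_same_cell (hq : Measurable q) :
    MeasurableSet {p : α × α | q p.1 = q p.2} :=
  measurableSet_eq_fun (hq.comp measurable_fst) (hq.comp measurable_snd)

lemma measurable_measure_cell (hq : Measurable q) : Measurable fun x => μ (q ⁻¹' {q x}) :=
  (measurable_of_countable fun i => μ (q ⁻¹' {i})).comp hq

lemma measurable_blockDensity (hq : Measurable q) : Measurable (blockDensity μ q) :=
  ((measurable_measure_cell hq).comp measurable_fst).inv.indicator (measurableSet_same_cell hq)

lemma ae_lintegral_blockDensity [IsFiniteMeasure μ] (hq : Measurable q) :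
    ∀ᵐ x ∂μ, ∫⁻ y, blockDensity μ q (x, y) ∂μ = 1 := by
  filter_upwards [ae_measure_cell_ne_zero (μ := μ) (q := q)] with x hx
  rw [blockDensity_right_eq, lintegral_indicator_const (hq (measurableSet_singleton _)),
    ENNReal.inv_mul_cancel hx (measure_ne_top _ _)]

lemma blockCoupling_fst [IsFiniteMeasure μ] (hq : Measurable q) : (blockCoupling μ q).fst = μ := by
  ext s hs
  rw [Measure.fst_apply hs, blockCoupling, withDensity_apply _ (measurable_fst hs),
    ← lintegral_indicator (measurable_fst hs),
    lintegral_prod _ ((measurable_blockDensity hq).indicator (measurable_fst hs)).aemeasurable,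
    ← lintegral_indicator_one hs]
  refine lintegral_congr_ae ?_
  filter_upwards [ae_lintegral_blockDensity (μ := μ) hq] with x hx
  by_cases h : x ∈ s
  · simpa [Set.indicator, h] using hx
  · simp [Set.indicator, h]

lemma blockCoupling_map_swap [SFinite μ] (hq : Measurable q) :
    (blockCoupling μ q).map Prod.swap = blockCoupling μ q := by
  ext s hs
  rw [Measure.map_apply measurable_swap hs, blockCoupling, withDensity_apply _ (measurable_swap hs),
    withDensity_apply _ hs]
  conv_rhs => rw [← Measure.prod_swap]
  rw [setLIntegral_map hs (measurable_blockDensity hq) measurable_swap]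
  simp_rw [blockDensity_swap]

lemma blockCoupling_snd [IsFiniteMeasure μ] (hq : Measurable q) : (blockCoupling μ q).snd = μ := by
  rw [← blockCoupling_map_swap hq, Measure.snd_map_swap, blockCoupling_fst hq]

lemma isProbabilityMeasure_blockCoupling [IsProbabilityMeasure μ] (hq : Measurable q) :
    IsProbabilityMeasure (blockCoupling μ q) := by
  constructor
  rw [← Measure.fst_univ, blockCoupling_fst hq, measure_univ]

lemma ae_blockCoupling_same_cell (hq : Measurable q) :
    ∀ᵐ p ∂blockCoupling μ q, q p.1 = q p.2 := by
  rw [blockCoupling, ae_withDensity_iff (measurable_blockDensity hq)]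
  refine Filter.Eventually.of_forall fun p hp => ?_
  by_contra h
  exact hp (by simp [blockDensity, h])

/-- The integral is the sum over cells of mass times inverse mass: each charged cell contributes
one, each null cell zero. -/
lemma lintegral_blockDensity_blockCoupling_le [IsFiniteMeasure μ] (hq : Measurable q)
    {s : Finset ι} (hs : ∀ᵐ x ∂μ, q x ∈ s) :
    ∫⁻ p, blockDensity μ q p ∂blockCoupling μ q ≤ s.card := by
  have h1 : ∫⁻ p, blockDensity μ q p ∂blockCoupling μ q
      = ∫⁻ p, (μ (q ⁻¹' {q p.1}))⁻¹ ∂blockCoupling μ q := by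
    refine lintegral_congr_ae ?_
    filter_upwards [ae_blockCoupling_same_cell hq] with p hp
    simp [blockDensity, Set.indicator, hp]
  have hmeas : Measurable fun i => (μ (q ⁻¹' {i}))⁻¹ := measurable_of_countable _
  have h2 : ∫⁻ p, (μ (q ⁻¹' {q p.1}))⁻¹ ∂blockCoupling μ q = ∫⁻ x, (μ (q ⁻¹' {q x}))⁻¹ ∂μ := by
    rw [← lintegral_map (f := fun x => (μ (q ⁻¹' {q x}))⁻¹) (hmeas.comp hq) measurable_fst,
      ← Measure.fst, blockCoupling_fst hq]
  rw [h1, h2, ← lintegral_map (f := fun i => (μ (q ⁻¹' {i}))⁻¹) hmeas hq, lintegral_countable',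
    tsum_eq_sum (s := s)]
  · calc _ ≤ ∑ i ∈ s, (1 : ℝ≥0∞) := by
          refine Finset.sum_le_sum fun i _ => ?_
          rw [Measure.map_apply hq (measurableSet_singleton i)]
          exact ENNReal.inv_mul_le_one _
      _ = s.card := by simp
  · intro i hi
    have : μ (q ⁻¹' {i}) = 0 := by
      refine measure_mono_null ?_ hs
      rintro x rfl
      exact hi
    rw [Measure.map_apply hq (measurableSet_singleton i), this, mul_zero]

lemma klDiv_blockCoupling_le [IsProbabilityMeasure μ] (hq : Measurable q)
    {s : Finset ι} (hs : ∀ᵐ x ∂μ, q x ∈ s) :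
    klDiv (blockCoupling μ q) (μ.prod μ) ≤ ENNReal.ofReal (Real.log s.card) := by
  have hp := isProbabilityMeasure_blockCoupling (μ := μ) hq
  have hpos : (0 : ℝ) < s.card := by
    obtain ⟨x, hx⟩ := hs.exists
    exact_mod_cast Finset.card_pos.2 ⟨_, hx⟩
  rw [blockCoupling] at hp ⊢
  refine klDiv_withDensity_le_log (measurable_blockDensity hq) ?_ hpos ?_
  · filter_upwards [ae_blockCoupling_same_cell (μ := μ) hq] with p hp
    simp [blockDensity, Set.indicator, hp, prob_le_one]
  · rw [ENNReal.ofReal_natCast]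
    exact lintegral_blockDensity_blockCoupling_le hq hs

end Block

/-! ### Barycentric projection and Jensen. -/

section Barycenter

variable {d : ℕ}

lemma eLpNorm_two_sq {α E : Type*} [MeasurableSpace α] [NormedAddCommGroup E] (μ : Measure α)
    (g : α → E) : eLpNorm g 2 μ ^ 2 = ∫⁻ x, ‖g x‖ₑ ^ 2 ∂μ := by
  simpa using eLpNorm_nnreal_pow_eq_lintegral (f := g) (μ := μ) (p := 2) two_ne_zero

lemma enorm_integral_sq_le {α E : Type*} [MeasurableSpace α] [NormedAddCommGroup E]
    [NormedSpace ℝ E] {μ : Measure α} [IsProbabilityMeasure μ] {g : α → E}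
    (hg : AEStronglyMeasurable g μ) : ‖∫ x, g x ∂μ‖ₑ ^ 2 ≤ ∫⁻ x, ‖g x‖ₑ ^ 2 ∂μ := by
  rw [← eLpNorm_two_sq]
  gcongr
  refine (enorm_integral_le_lintegral_enorm g).trans ?_
  rw [← eLpNorm_one_eq_lintegral_enorm]
  exact eLpNorm_le_eLpNorm_of_exponent_le one_le_two hg

/-- The difference at `x` is the mean of `y - T x` under the conditional law; apply Jensen fibrewise
and integrate. -/
lemma barycentricProjection_sub_memLp
    {γ : Measure (EuclideanSpace ℝ (Fin d) × EuclideanSpace ℝ (Fin d))} [IsProbabilityMeasure γ]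
    {T : EuclideanSpace ℝ (Fin d) → EuclideanSpace ℝ (Fin d)} (hT : Measurable T)
    (hint : Integrable (fun p => ‖p.2 - T p.1‖ ^ 2) γ) :
    MemLp (fun x => barycentricProjection γ x - T x) 2 γ.fst ∧
      (eLpNorm (fun x => barycentricProjection γ x - T x) 2 γ.fst).toReal ^ 2
        ≤ ∫ p, ‖p.2 - T p.1‖ ^ 2 ∂γ := by
  have hgm : Measurable fun p : EuclideanSpace ℝ (Fin d) × EuclideanSpace ℝ (Fin d) =>
    p.2 - T p.1 := measurable_snd.sub (hT.comp measurable_fst)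
  have hLp : MemLp (fun p => p.2 - T p.1) 2 γ :=
    (memLp_two_iff_integrable_sq_norm hgm.aestronglyMeasurable).2 hint
  have hae : ∀ᵐ x ∂γ.fst, barycentricProjection γ x - T x
      = ∫ y, (y - T x) ∂γ.condKernel x := by
    filter_upwards [(hLp.integrable one_le_two).condKernel_ae] with x hx
    have hy : Integrable (fun y => y) (γ.condKernel x) := by
      simpa [Pi.add_def] using hx.add (integrable_const (T x))
    rw [integral_sub hy (integrable_const _)]
    simp [barycentricProjection]
  have hmeas : AEStronglyMeasurable (fun x => barycentricProjection γ x - T x) γ.fst :=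
    (measurable_snd.aestronglyMeasurable (μ := γ)).integral_condKernel.sub hT.aestronglyMeasurable
  have hle : eLpNorm (fun x => barycentricProjection γ x - T x) 2 γ.fst ^ 2
      ≤ ENNReal.ofReal (∫ p, ‖p.2 - T p.1‖ ^ 2 ∂γ) := by
    rw [ofReal_integral_eq_lintegral_ofReal hint (Filter.Eventually.of_forall fun p => sq_nonneg _),
      eLpNorm_two_sq, ← Measure.lintegral_condKernel (by fun_prop)]
    refine lintegral_mono_ae ?_
    filter_upwards [hae] with x hx
    rw [hx]
    refine (enorm_integral_sq_le (by fun_prop)).trans_eq ?_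
    simp_rw [ENNReal.ofReal_pow (norm_nonneg _), ofReal_norm]
  refine ⟨⟨hmeas, ?_⟩, ?_⟩
  · by_contra h
    rw [not_lt, top_le_iff] at h
    rw [h] at hle
    simp at hle
  · rw [← ENNReal.toReal_pow]
    exact ENNReal.toReal_le_of_le_ofReal (integral_nonneg fun p => sq_nonneg _) hle

end Barycenter

/-! ### Integration against couplings. -/

section Coupling

variable {X Y : Type*} [MeasurableSpace X] [MeasurableSpace Y] {μ : Measure X} {ν : Measure Y}
  {γ : Measure (X × Y)}

lemma IsCoupling.ae_fst (h : IsCoupling μ ν γ) {p : X → Prop} (hp : ∀ᵐ x ∂μ, p x) :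
    ∀ᵐ z ∂γ, p z.1 := by
  rw [← h.fst_eq] at hp
  exact ae_of_ae_map measurable_fst.aemeasurable hp

lemma IsCoupling.ae_snd (h : IsCoupling μ ν γ) {p : Y → Prop} (hp : ∀ᵐ y ∂ν, p y) :
    ∀ᵐ z ∂γ, p z.2 := by
  rw [← h.snd_eq] at hp
  exact ae_of_ae_map measurable_snd.aemeasurable hp

lemma IsCoupling.integral_fst (h : IsCoupling μ ν γ) {g : X → ℝ} (hg : AEStronglyMeasurable g μ) :
    ∫ z, g z.1 ∂γ = ∫ x, g x ∂μ := by
  rw [← h.fst_eq] at hg ⊢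
  exact (integral_map measurable_fst.aemeasurable hg).symm

lemma IsCoupling.integral_snd (h : IsCoupling μ ν γ) {g : Y → ℝ} (hg : AEStronglyMeasurable g ν) :
    ∫ z, g z.2 ∂γ = ∫ y, g y ∂ν := by
  rw [← h.snd_eq] at hg ⊢
  exact (integral_map measurable_snd.aemeasurable hg).symm

lemma Continuous.integrable_of_ae_mem_isCompact {Z : Type*} [TopologicalSpace Z]
    [MeasurableSpace Z] [OpensMeasurableSpace Z] [T2Space Z] {ρ : Measure Z} [IsFiniteMeasure ρ]
    {K : Set Z} (hK : IsCompact K) (hρ : ∀ᵐ z ∂ρ, z ∈ K) {g : Z → ℝ} (hg : Continuous g) :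
    Integrable g ρ := by
  rw [← Measure.restrict_eq_self_of_ae_mem hρ]
  exact hg.continuousOn.integrableOn_compact hK

end Coupling

/-! ### Duality gap and optimality. -/

section DualityGap

variable {d : ℕ} {μ ν : Measure (EuclideanSpace ℝ (Fin d))} {K L : Set (EuclideanSpace ℝ (Fin d))}
  {f : EuclideanSpace ℝ (Fin d) → ℝ} {T : EuclideanSpace ℝ (Fin d) → EuclideanSpace ℝ (Fin d)}
  {γ γ' : Measure (EuclideanSpace ℝ (Fin d) × EuclideanSpace ℝ (Fin d))}

/-- The duality gap `f x + f* y - ⟪x, y⟫`, with the conjugate computed over `K`. -/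
noncomputable def dualityGap (K : Set (EuclideanSpace ℝ (Fin d)))
    (f : EuclideanSpace ℝ (Fin d) → ℝ)
    (p : EuclideanSpace ℝ (Fin d) × EuclideanSpace ℝ (Fin d)) : ℝ :=
  f p.1 + conjugateOn K f p.2 - inner ℝ p.1 p.2

lemma continuous_dualityGap (hK : IsCompact K) (hf : Continuous f) :
    Continuous (dualityGap K f) := by
  have := continuous_conjugateOn hK hf
  unfold dualityGap
  fun_prop

lemma ConvexOn.dualityGap_gradient (hf : ConvexOn ℝ Set.univ f)
    (hT : ∀ x, HasGradientAt f (T x) x) (x : EuclideanSpace ℝ (Fin d))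
    {y : EuclideanSpace ℝ (Fin d)} (hy : y ∈ K) :
    dualityGap K f (x, T y) = f x - f y - inner ℝ (T y) (x - y) := by
  simp only [dualityGap, hf.conjugateOn_gradient hy (hT y)]
  rw [inner_sub_right, real_inner_comm y, real_inner_comm x]
  ring

lemma IsCoupling.ae_mem_prod (h : IsCoupling μ ν γ) (hK : ∀ᵐ x ∂μ, x ∈ K)
    (hL : ∀ᵐ y ∂ν, y ∈ L) : ∀ᵐ p ∂γ, p ∈ K ×ˢ L := by
  filter_upwards [h.ae_fst hK, h.ae_snd hL] with p h1 h2 using ⟨h1, h2⟩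

lemma IsCoupling.integral_cost_eq [IsProbabilityMeasure μ] [IsProbabilityMeasure ν]
    [IsProbabilityMeasure γ] (h : IsCoupling μ ν γ)
    (hK : IsCompact K) (hμK : ∀ᵐ x ∂μ, x ∈ K) (hL : IsCompact L) (hνL : ∀ᵐ y ∂ν, y ∈ L)
    (hf : Continuous f) :
    ∫ p, ‖p.1 - p.2‖ ^ 2 / 2 ∂γ = ∫ p, dualityGap K f p ∂γ +
      (∫ x, (‖x‖ ^ 2 / 2 - f x) ∂μ + ∫ y, (‖y‖ ^ 2 / 2 - conjugateOn K f y) ∂ν) := by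
  have hφ := continuous_conjugateOn hK hf
  have hint {g : EuclideanSpace ℝ (Fin d) × EuclideanSpace ℝ (Fin d) → ℝ} (hg : Continuous g) :
      Integrable g γ :=
    hg.integrable_of_ae_mem_isCompact (hK.prod hL) (h.ae_mem_prod hμK hνL)
  have ha : Continuous fun x => ‖x‖ ^ 2 / 2 - f x := by fun_prop
  have hb : Continuous fun y => ‖y‖ ^ 2 / 2 - conjugateOn K f y := by fun_prop
  rw [← h.integral_fst ha.aestronglyMeasurable, ← h.integral_snd hb.aestronglyMeasurable,
    ← integral_add (hint (by fun_prop)) (hint (by fun_prop)),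
    ← integral_add (hint (continuous_dualityGap hK hf)) (hint (by fun_prop))]
  refine integral_congr_ae (Filter.Eventually.of_forall fun p => ?_)
  simp only [dualityGap]
  rw [norm_sub_sq_real]
  ring

/-- The entropy of `γ` is nonnegative and is dropped; the one-variable terms agree for both
couplings and cancel. -/
lemma IsOptimalEntropicPlan.integral_dualityGap_le [IsProbabilityMeasure μ]
    [IsProbabilityMeasure ν] [IsProbabilityMeasure γ] [IsProbabilityMeasure γ'] {ε : ℝ} (hε : 0 < ε)
    (h : IsOptimalEntropicPlan μ ν ε γ) (h' : IsCoupling μ ν γ')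
    (hK : IsCompact K) (hμK : ∀ᵐ x ∂μ, x ∈ K) (hL : IsCompact L) (hνL : ∀ᵐ y ∂ν, y ∈ L)
    (hf : Continuous f) {H : ℝ} (hH : 0 ≤ H) (hkl : klDiv γ' (μ.prod ν) ≤ ENNReal.ofReal H) :
    ∫ p, dualityGap K f p ∂γ ≤ ∫ p, dualityGap K f p ∂γ' + ε * H := by
  have hcost {ρ : Measure (EuclideanSpace ℝ (Fin d) × EuclideanSpace ℝ (Fin d))}
      [IsProbabilityMeasure ρ] (hρ : IsCoupling μ ν ρ) :
      ∫⁻ p, ENNReal.ofReal (‖p.1 - p.2‖ ^ 2 / 2) ∂ρ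
        = ENNReal.ofReal (∫ p, ‖p.1 - p.2‖ ^ 2 / 2 ∂ρ) := by
    refine (ofReal_integral_eq_lintegral_ofReal ?_
      (Filter.Eventually.of_forall fun p => by positivity)).symm
    exact Continuous.integrable_of_ae_mem_isCompact (hK.prod hL) (hρ.ae_mem_prod hμK hνL)
      (by fun_prop)
  have hle : ENNReal.ofReal (∫ p, ‖p.1 - p.2‖ ^ 2 / 2 ∂γ)
      ≤ ENNReal.ofReal (∫ p, ‖p.1 - p.2‖ ^ 2 / 2 ∂γ' + ε * H) := by
    calc ENNReal.ofReal (∫ p, ‖p.1 - p.2‖ ^ 2 / 2 ∂γ) ≤ entropicFunctional μ ν ε γ := by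
          rw [← hcost h.coupling, entropicFunctional]
          exact le_self_add
      _ ≤ entropicFunctional μ ν ε γ' := h.minimal γ' h'
      _ ≤ ENNReal.ofReal (∫ p, ‖p.1 - p.2‖ ^ 2 / 2 ∂γ') + ENNReal.ofReal ε * ENNReal.ofReal H := by
          rw [entropicFunctional, hcost h']
          gcongr
      _ = _ := by
          rw [← ENNReal.ofReal_mul hε.le, ← ENNReal.ofReal_add _ (by positivity)]
          exact integral_nonneg fun p => by positivity
  rw [ENNReal.ofReal_le_ofReal_iff (add_nonneg (integral_nonneg fun p => by positivity)
    (by positivity)), h.coupling.integral_cost_eq hK hμK hL hνL hf,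
    h'.integral_cost_eq hK hμK hL hνL hf] at hle
  linarith

end DualityGap

/-! ### The competitor plan. -/

section Competitor

variable {d : ℕ} {μ : Measure (EuclideanSpace ℝ (Fin d))} [IsProbabilityMeasure μ]
  {T : EuclideanSpace ℝ (Fin d) → EuclideanSpace ℝ (Fin d)}
  {K : Set (EuclideanSpace ℝ (Fin d))} {f : EuclideanSpace ℝ (Fin d) → ℝ}

lemma isCoupling_map_blockCoupling {ι : Type*} [MeasurableSpace ι] [Countable ι]
    [MeasurableSingletonClass ι] {q : EuclideanSpace ℝ (Fin d) → ι} (hq : Measurable q)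
    (hT : Measurable T) :
    IsCoupling μ (μ.map T) ((blockCoupling μ q).map (Prod.map id T)) := by
  have hm : Measurable (Prod.map (id : EuclideanSpace ℝ (Fin d) → _) T) := measurable_id.prodMap hT
  constructor
  · rw [Measure.fst, Measure.map_map measurable_fst hm]
    exact blockCoupling_fst hq
  · rw [Measure.snd, Measure.map_map measurable_snd hm]
    conv_rhs => rw [← blockCoupling_snd (μ := μ) hq]
    rw [Measure.snd, Measure.map_map hT measurable_snd]
    rfl

/-- Data processing: the plan and the reference measure are images of `blockCoupling μ q` and
`μ.prod μ` under the same map. -/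
lemma klDiv_map_blockCoupling_le {ι : Type*} [MeasurableSpace ι] [Countable ι]
    [MeasurableSingletonClass ι] {q : EuclideanSpace ℝ (Fin d) → ι} (hq : Measurable q)
    (hT : Measurable T) {s : Finset ι} (hs : ∀ᵐ x ∂μ, q x ∈ s) :
    klDiv ((blockCoupling μ q).map (Prod.map id T)) (μ.prod (μ.map T))
      ≤ ENNReal.ofReal (Real.log s.card) := by
  have := isProbabilityMeasure_blockCoupling (μ := μ) hq
  have h : μ.prod (μ.map T) = (μ.prod μ).map (Prod.map id T) := by
    rw [← Measure.map_prod_map μ μ measurable_id hT, Measure.map_id]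
  rw [h]
  exact (klDiv_map_le _ _ (measurable_id.prodMap hT)).trans (klDiv_blockCoupling_le hq hs)

lemma integral_dualityGap_map_blockCoupling_gridIndex_le (hK : IsCompact K)
    (hμK : ∀ᵐ x ∂μ, x ∈ K) (hf : ConvexOn ℝ Set.univ f) (hT : ∀ x, HasGradientAt f (T x) x)
    {M : ℝ≥0} (hM : LipschitzWith M T) {δ : ℝ} (hδ : 0 < δ) :
    ∫ p, dualityGap K f p ∂(blockCoupling μ (gridIndex δ)).map (Prod.map id T)
      ≤ M / 2 * (d * δ ^ 2) := by
  have hq := measurable_gridIndex (d := d) δ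
  have := isProbabilityMeasure_blockCoupling (μ := μ) hq
  have hfc : Continuous f := continuous_iff_continuousAt.2 fun x => (hT x).continuousAt
  rw [integral_map (measurable_id.prodMap hM.continuous.measurable).aemeasurable
    (continuous_dualityGap hK hfc).aestronglyMeasurable]
  have hsnd : ∀ᵐ p ∂blockCoupling μ (gridIndex δ), p.2 ∈ K := by
    rw [← blockCoupling_snd (μ := μ) hq] at hμK
    exact ae_of_ae_map measurable_snd.aemeasurable hμK
  have hle : ∀ᵐ p ∂blockCoupling μ (gridIndex δ),
      dualityGap K f (Prod.map id T p) ≤ M / 2 * (d * δ ^ 2) := by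
    filter_upwards [hsnd, ae_blockCoupling_same_cell hq] with p hp hpq
    rw [Prod.map_apply', hf.dualityGap_gradient hT _ hp]
    have h1 := hM.le_add_inner_add_of_hasGradientAt hT p.2 p.1
    have h2 := norm_sub_sq_le_of_gridIndex_eq hδ hpq
    calc _ ≤ (M : ℝ) / 2 * ‖p.1 - p.2‖ ^ 2 := by simp only [id]; linarith
      _ ≤ _ := by gcongr
  -- Nonnegativity of the gap, from convexity, replaces a proof of its integrability.
  refine (integral_mono_of_nonneg ?_ (integrable_const _) hle).trans_eq (by simp)
  filter_upwards [hsnd] with p hp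
  have h1 := hf.add_inner_le_of_hasGradientAt (hT p.2) p.1
  rw [Prod.map_apply', hf.dualityGap_gradient hT _ hp]
  simp only [id, Pi.zero_apply]
  linarith

end Competitor

theorem mainTheorem9 {d : ℕ} (μ ν : Measure (EuclideanSpace ℝ (Fin d)))
    [IsProbabilityMeasure μ] [IsProbabilityMeasure ν]
    (hμ : IsCompact μ.support) (hν : IsCompact ν.support)
    (f : EuclideanSpace ℝ (Fin d) → ℝ)
    (T : EuclideanSpace ℝ (Fin d) → EuclideanSpace ℝ (Fin d))
    (hT : IsBrenierMap μ ν f T) (M : ℝ≥0) (hM : LipschitzWith M T) :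
    ∃ C : ℝ, ∀ ε : ℝ, 0 < ε → ε < 1 →
      ∀ (γ : Measure (EuclideanSpace ℝ (Fin d) × EuclideanSpace ℝ (Fin d)))
        [IsProbabilityMeasure γ], IsOptimalEntropicPlan μ ν ε γ →
        (Integrable (fun p => ‖p.2 - T p.1‖ ^ 2) γ ∧
          ∫ p, ‖p.2 - T p.1‖ ^ 2 ∂γ ≤ M * (d * ε * Real.log (1 / ε) + C * ε)) ∧
        (MemLp (fun x => barycentricProjection γ x - T x) 2 μ ∧
          (eLpNorm (fun x => barycentricProjection γ x - T x) 2 μ).toReal ^ 2 ≤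
            M * (d * ε * Real.log (1 / ε) + C * ε)) := by
  obtain ⟨hconv, hgrad, rfl⟩ := hT
  have hTm : Measurable T := hM.continuous.measurable
  have hfc : Continuous f := continuous_iff_continuousAt.2 fun x => (hgrad x).continuousAt
  set K := μ.support
  have hμK : ∀ᵐ x ∂μ, x ∈ K := Measure.support_mem_ae
  -- Points of `T '' K` come with a preimage in `K`, which the Bregman formula for the gap needs.
  have hL : IsCompact (T '' K) := hμ.image hM.continuous
  have hνL : ∀ᵐ y ∂μ.map T, y ∈ T '' K := by
    refine (ae_map_iff hTm.aemeasurable hL.measurableSet).2 ?_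
    filter_upwards [hμK] with x hx using Set.mem_image_of_mem T hx
  obtain ⟨A, hA, hcard⟩ := exists_finset_gridIndex_mem hμ
  -- `M * d` comes from the competitor's gap, `2 * d * log A` from the cell count, after factoring
  -- `M` out of `2 * M`.
  refine ⟨M * d + 2 * d * Real.log A, fun ε hε hε1 γ _ hγ => ?_⟩
  have hint : Integrable (fun p => ‖p.2 - T p.1‖ ^ 2) γ := by
    have := hM.continuous
    exact Continuous.integrable_of_ae_mem_isCompact (hμ.prod hL)
      (hγ.coupling.ae_mem_prod hμK hνL) (by fun_prop)
  have hbound : ∫ p, ‖p.2 - T p.1‖ ^ 2 ∂γ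
      ≤ M * (d * ε * Real.log (1 / ε) + (M * d + 2 * d * Real.log A) * ε) := by
    -- Mesh `√ε` keeps the gap of order `ε`, and the square root halves `log (1 / ε)`, which offsets
    -- the 2 in `2 * M`.
    have hδ : 0 < √ε := Real.sqrt_pos.2 hε
    obtain ⟨s, hs, hsc⟩ := hcard (√ε) hδ (Real.sqrt_le_one.2 hε1.le)
    have hsμ : ∀ᵐ x ∂μ, gridIndex √ε x ∈ s := hμK.mono hs
    have hs1 : (1 : ℝ) ≤ s.card := by
      obtain ⟨x, hx⟩ := hsμ.exists
      exact_mod_cast Finset.card_pos.2 ⟨_, hx⟩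
    have hq := measurable_gridIndex (d := d) √ε
    have := isProbabilityMeasure_blockCoupling (μ := μ) hq
    have : IsProbabilityMeasure ((blockCoupling μ (gridIndex √ε)).map (Prod.map id T)) :=
      Measure.isProbabilityMeasure_map (measurable_id.prodMap hTm).aemeasurable
    have hgap := hγ.integral_dualityGap_le hε (isCoupling_map_blockCoupling hq hTm)
      hμ hμK hL hνL hfc (Real.log_nonneg hs1) (klDiv_map_blockCoupling_le hq hTm hsμ)
    have hcomp := integral_dualityGap_map_blockCoupling_gridIndex_le hμ hμK hconv hgrad hM hδ
    rw [Real.sq_sqrt hε.le] at hcomp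
    have hlog : Real.log s.card ≤ d * (Real.log A + Real.log (1 / ε) / 2) := by
      refine (Real.log_le_log (by linarith) hsc).trans_eq ?_
      rw [Real.log_pow, Real.log_div hA.ne' hδ.ne', Real.log_sqrt hε.le, one_div, Real.log_inv]
      ring
    calc ∫ p, ‖p.2 - T p.1‖ ^ 2 ∂γ ≤ ∫ p, 2 * M * dualityGap K f p ∂γ := by
          have hgi : Integrable (dualityGap K f) γ :=
            (continuous_dualityGap hμ hfc).integrable_of_ae_mem_isCompact (hμ.prod hL)
              (hγ.coupling.ae_mem_prod hμK hνL)
          refine integral_mono_ae hint (hgi.const_mul _) ?_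
          filter_upwards [hγ.coupling.ae_snd hνL] with p hp
          obtain ⟨x, hx, hxp⟩ := hp
          have e : p = (p.1, T x) := by rw [hxp]
          rw [e, hconv.dualityGap_gradient hgrad _ hx, norm_sub_rev]
          exact hconv.norm_sub_sq_le_of_lipschitzWith_gradient hgrad hM p.1 x
      _ = 2 * M * ∫ p, dualityGap K f p ∂γ := integral_const_mul _ _
      _ ≤ 2 * M * (M / 2 * (d * ε) + ε * (d * (Real.log A + Real.log (1 / ε) / 2))) := by
          gcongr
          exact hgap.trans (by gcongr)
      _ = _ := by ring
  have hb := barycentricProjection_sub_memLp hTm hint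
  rw [hγ.coupling.fst_eq] at hb
  exact ⟨⟨hint, hbound⟩, hb.1, hb.2.trans hbound⟩
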